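/- Let $G$ be a compactly generated locally compact (Hausdorff) topological group. A \emph{Specker compactification} of $G$ is a compact Hausdorff space $X$ containing $G$ as a dense open subspace such that: (i) the boundary $X\setminus G$ is non-empty and totally disconnected (its only connected subsets are the singletons); (ii) the map $\hat R:G\times X\to X$ given by $\hat R(g,x)=xg$ if $x\in G$ and $\hat R(g,x)=x$ if $x\in X\setminus G$ is continuous; (iii) for every $g\in G$ the left multiplication $h\mapsto gh$ of $G$ extends to a continuous map $\hat L_g:X\to X$. These (unique) extensions define an action $\hat L:G\times X\to X$, $\hat L(g,x)=\hat L_g(x)$, of $G$ on $X$. Given $a,b\in X$, a net $(g_n)_n$ in $G$ \emph{collapses} to $a$ except at $b$ if for every compact $K\subseteq X\setminus\{b\}$ and every neighborhood $U$ of $a$ in $X$ one has $\hat L_{g_n}(K)\subseteq U$ for all $n$ large enough. Let $X$ be any Specker compactification of $G$. Then the action $\hat L:G\times X\to X$ is continuous and has the convergence property: every net in $G$ that has no subnet converging to an element of $G$ has a subnet that collapses to some $a\in X$ except at some $b\in X$. Moreover its limit set, that is, the set of all $a\in X$ such that for some $b\in X$ there is a net in $G$ that collapses to $a$ except at $b$,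 is exactly $X\setminus G$. -/

import Mathlib

open Set Filter Topology

universe u v w

/-- A net `z : D → G` (indexed by a nonempty directed preorder `D`) is *wandering* if it has no
cluster point, i.e. no subnet `z ∘ N` of it converges to a point of `G`. -/
def IsWanderingNet {G : Type u} [TopologicalSpace G] {D : Type w} [Preorder D]
    (z : D → G) : Prop :=
  ¬ ∃ x : G, ∃ (E : Type (max u w)) (_ : Preorder E) (_ : IsDirectedOrder E) (_ : Nonempty E)
    (N : E → D), (∀ d : D, ∀ᶠ e in atTop, d ≤ N e) ∧ Tendsto (z ∘ N) atTop (𝓝 x)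

/-- The net `z : D → G` *collapses* to `a` except at `b`: for every compact subset `K` of
`T \ {b}` and every neighborhood `U` of `a`, `z n • K ⊆ U` for `n` large enough. -/
def CollapsesTo {G : Type u} {T : Type v} [TopologicalSpace T] [SMul G T]
    {D : Type w} [Preorder D] (z : D → G) (b a : T) : Prop :=
  ∀ K : Set T, IsCompact K → K ⊆ {b}ᶜ → ∀ U ∈ 𝓝 a, ∀ᶠ n in atTop, (fun t => z n • t) '' K ⊆ U

/-- The action of `G` on `T` has the *convergence property*: every wandering net on `G` has a
collapsing subnet. (The universe of the index set of the net is arbitrary; that of the subnet is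
large enough for the usual constructions of subnets.) -/
def IsConvergenceAction (G : Type u) (T : Type v) [TopologicalSpace G] [TopologicalSpace T]
    [SMul G T] : Prop :=
  ∀ (D : Type w) [Preorder D] [IsDirectedOrder D] [Nonempty D] (z : D → G), IsWanderingNet z →
    ∃ (E : Type (max u v w)) (_ : Preorder E) (_ : IsDirectedOrder E) (_ : Nonempty E)
      (N : E → D), (∀ d : D, ∀ᶠ e in atTop, d ≤ N e) ∧ ∃ b a : T, CollapsesTo (z ∘ N) b a

/-- The *limit set* of the action of `G` on `T`: the set of attractive points, i.e. of all `a`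
such that some net on `G` collapses to `a` (except at some `b`). -/
def limitSet (G : Type u) (T : Type v) [TopologicalSpace T] [SMul G T] : Set T :=
  {a | ∃ b : T, ∃ (D : Type (max u v w)) (_ : Preorder D) (_ : IsDirectedOrder D) (_ : Nonempty D)
    (z : D → G), CollapsesTo z b a}

/-- A topological group is *compactly generated* if some compact subset generates it. -/
def IsCompactlyGeneratedGroup (G : Type u) [Group G] [TopologicalSpace G] : Prop :=
  ∃ K : Set G, IsCompact K ∧ Subgroup.closure K = ⊤

/-- The map `R̂ (g, x) = x * g` for `x ∈ G`, and `R̂ (g, x) = x` for `x ∈ X \ G`, where `G` is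
identified with its image under the injective map `ι : G → X`. -/
noncomputable def rightExtension {G : Type u} {X : Type v} [Group G] (ι : G → X) (p : G × X) : X :=
  Function.extend ι (fun h => ι (h * p.1)) id p.2

/-- `X`, with the embedding `ι : G → X`, is a *Specker compactification* of `G`. By convention the
empty space is not totally disconnected, so that the boundary `X \ G` is nonempty. -/
structure IsSpeckerCompactification {G : Type u} {X : Type v} [Group G] [TopologicalSpace G]
    [TopologicalSpace X] (ι : G → X) : Prop where
  compactSpace : CompactSpace X
  t2Space : T2Space X
  isOpenEmbedding : IsOpenEmbedding ι
  denseRange : DenseRange ι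
  boundary_nonempty : ((range ι)ᶜ).Nonempty
  boundary_totallyDisconnected : IsTotallyDisconnected (range ι)ᶜ
  continuous_rightExtension : Continuous (rightExtension ι)
  exists_leftExtension : ∀ g : G, ∃ f : X → X, Continuous f ∧ ∀ h : G, f (ι h) = ι (g * h)

namespace IsSpeckerCompactification

variable {G : Type u} {X : Type v} [Group G] [TopologicalSpace G] [TopologicalSpace X] {ι : G → X}

/-- The continuous extension `L̂_g : X → X` of the left multiplication by `g`. -/
noncomputable def leftExtension (hX : IsSpeckerCompactification ι) (g : G) : X → X :=
  (hX.exists_leftExtension g).choose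

theorem continuous_leftExtension (hX : IsSpeckerCompactification ι) (g : G) :
    Continuous (hX.leftExtension g) :=
  (hX.exists_leftExtension g).choose_spec.1

theorem leftExtension_apply (hX : IsSpeckerCompactification ι) (g h : G) :
    hX.leftExtension g (ι h) = ι (g * h) :=
  (hX.exists_leftExtension g).choose_spec.2 h

/-- `L̂_g` is the only continuous extension of the left multiplication by `g`. -/
theorem eq_leftExtension (hX : IsSpeckerCompactification ι) (g : G) {f : X → X}
    (hf : Continuous f) (h : ∀ k : G, f (ι k) = ι (g * k)) : f = hX.leftExtension g := by
  have := hX.t2Space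
  refine hX.denseRange.equalizer hf (hX.continuous_leftExtension g) (funext fun k => ?_)
  simp [h, hX.leftExtension_apply]

/-- The left action `L̂ (g, x) = L̂_g x` of `G` on `X`. -/
noncomputable abbrev leftAction (hX : IsSpeckerCompactification ι) : MulAction G X where
  smul g x := hX.leftExtension g x
  one_smul x := congrFun (hX.eq_leftExtension 1 continuous_id (by simp)).symm x
  mul_smul g h x := congrFun (hX.eq_leftExtension (g * h)
    ((hX.continuous_leftExtension g).comp (hX.continuous_leftExtension h))
    (by simp [hX.leftExtension_apply, mul_assoc])).symm x

end IsSpeckerCompactification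

/-! ### Preliminaries on frontiers, generating sets and nets. -/

open scoped Pointwise

/-! Right translations fix the boundary pointwise and it is totally disconnected, so boundary points
have small neighborhoods `A` with frontier inside `G`. Outside a compact set, right multiplication
by generators does not change membership in such an `A`. Continuity and collapsing both follow by
one connectedness argument: a set of exceptional `p` that is stable under right multiplication by
generators and omits `1` is empty (`eq_empty_of_mul_mem_of_one_notMem`). For continuity, `p` is
exceptional if a small `g` changes its membership in `A`; for collapsing, if `p ∉ B` and `z n * p ∉
A`, with `A` near `a` and `B` near `b`. -/

theorem eventually_mem_iff_of_notMem_frontier {X : Type*} [TopologicalSpace X] {A : Set X} {x : X}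
    (hx : x ∉ frontier A) : ∀ᶠ y in 𝓝 x, (y ∈ A ↔ x ∈ A) := by
  by_cases hA : x ∈ closure A
  · have hi : x ∈ interior A := by
      by_contra h
      exact hx ⟨hA, h⟩
    filter_upwards [mem_interior_iff_mem_nhds.1 hi] with y hy
    exact iff_of_true hy (interior_subset hi)
  · filter_upwards [isClosed_closure.isOpen_compl.mem_nhds hA] with y hy
    exact iff_of_false (fun h => hy (subset_closure h)) fun h => hA (subset_closure h)

/-- A set invariant under right multiplication by a symmetric generating set is empty or
everything. -/
theorem eq_empty_of_mul_mem_of_one_notMem {G : Type*} [Group G] {K S : Set G}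
    (hK : Subgroup.closure K = ⊤) (hS : ∀ p ∈ S, ∀ k ∈ K ∪ K⁻¹, p * k ∈ S) (h1 : (1 : G) ∉ S) :
    S = ∅ := by
  -- The equivalence, for all `p`, lets the induction pass to inverses.
  have key : ∀ g : G, ∀ p, p ∈ S ↔ p * g ∈ S := by
    intro g
    have hg : g ∈ Subgroup.closure K := by rw [hK]; trivial
    induction hg using Subgroup.closure_induction with
    | mem k hk =>
      refine fun p => ⟨fun hp => hS p hp k (Or.inl hk), fun hp => ?_⟩
      simpa using hS _ hp k⁻¹ (Or.inr (by simpa using hk))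
    | one => simp
    | mul x y _ _ hx hy => exact fun p => by rw [hx, hy, mul_assoc]
    | inv x _ hx => exact fun p => by rw [hx (p * x⁻¹), inv_mul_cancel_right]
  refine eq_empty_of_forall_notMem fun p hp => h1 ?_
  simpa using (key p⁻¹ p).1 hp

/-- Every proper filter is the limit of a net, with index set in an arbitrarily large universe. -/
theorem exists_net_tendsto {D : Type u} (F : Filter D) [F.NeBot] :
    ∃ (E : Type (max u v)) (_ : Preorder E) (_ : IsDirectedOrder E) (_ : Nonempty E)
      (N : E → D), Tendsto N atTop F := by
  let E₀ := {p : Set D × D // p.1 ∈ F ∧ p.2 ∈ p.1}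
  let E := ULift.{v} E₀
  let : Preorder E := Preorder.lift fun e : E => OrderDual.toDual e.down.1.1
  have hE : ∀ s ∈ F, ∃ e : E, e.down.1.1 = s := fun s hs =>
    let ⟨d, hd⟩ := Filter.nonempty_of_mem hs
    ⟨⟨⟨(s, d), hs, hd⟩⟩, rfl⟩
  refine ⟨E, inferInstance, ⟨fun e f => ?_⟩, ?_, fun e => e.down.1.2, fun s hs => ?_⟩
  · obtain ⟨c, hc⟩ := hE _ (inter_mem e.down.2.1 f.down.2.1)
    refine ⟨c, ?_, ?_⟩
    · change c.down.1.1 ⊆ e.down.1.1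
      exact hc ▸ inter_subset_left
    · change c.down.1.1 ⊆ f.down.1.1
      exact hc ▸ inter_subset_right
  · exact ⟨(hE univ univ_mem).choose⟩
  · obtain ⟨c, hc⟩ := hE s hs
    refine mem_map.2 (mem_of_superset (mem_atTop c) fun e he => ?_)
    have he' : e.down.1.1 ⊆ c.down.1.1 := he
    exact hc ▸ he' e.down.2.2

section RightExtension

variable {G : Type u} {X : Type v} [Group G] {ι : G → X}

theorem rightExtension_apply (hι : Function.Injective ι) (g h : G) :
    rightExtension ι (g, ι h) = ι (h * g) :=
  hι.extend_apply _ _ _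

theorem rightExtension_of_notMem_range {x : X} (hx : x ∉ range ι) (g : G) :
    rightExtension ι (g, x) = x :=
  Function.extend_apply' _ _ _ hx

end RightExtension

/-! ### Neighborhoods of boundary points and right translation. -/

namespace IsSpeckerCompactification

variable {G : Type u} {X : Type v} [Group G] [TopologicalSpace G] [TopologicalSpace X] {ι : G → X}

/-- Boundary points have a basis of neighborhoods whose frontier avoids the boundary. -/
theorem exists_isOpen_frontier_subset_range (hX : IsSpeckerCompactification ι) {x : X}
    (hx : x ∉ range ι) {U : Set X} (hU : U ∈ 𝓝 x) :
    ∃ A : Set X, IsOpen A ∧ x ∈ A ∧ closure A ⊆ U ∧ frontier A ⊆ range ι := by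
  have := hX.compactSpace
  have := hX.t2Space
  have hY : IsClosed (range ι)ᶜ := hX.isOpenEmbedding.isOpen_range.isClosed_compl
  have : CompactSpace ↥(range ι)ᶜ := isCompact_iff_compactSpace.1 hY.isCompact
  have : TotallyDisconnectedSpace ↥(range ι)ᶜ :=
    totallyDisconnectedSpace_subtype_iff.2 hX.boundary_totallyDisconnected
  obtain ⟨V, hV, hxV, hVU⟩ := compact_exists_isClopen_in_isOpen (x := (⟨x, hx⟩ : ↥(range ι)ᶜ))
    (isOpen_interior.preimage continuous_subtype_val : IsOpen (Subtype.val ⁻¹' interior U))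
    (mem_interior_iff_mem_nhds.2 hU)
  have hV₁ := hY.isClosedEmbedding_subtypeVal.isClosedMap _ hV.1
  have hV₂ := hY.isClosedEmbedding_subtypeVal.isClosedMap _ hV.compl.1
  -- `closure A` misses the rest of the boundary and `A` contains `V`, so no boundary point is on
  -- the frontier.
  obtain ⟨A, hA, hVA, hAU⟩ := normal_exists_closure_subset hV₁
    (isOpen_interior.inter hV₂.isOpen_compl) (by
      rintro _ ⟨y, hy, rfl⟩
      refine ⟨hVU hy, ?_⟩
      rintro ⟨z, hz, hzy⟩
      exact hz (Subtype.ext hzy ▸ hy))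
  refine ⟨A, hA, hVA ⟨_, hxV, rfl⟩, fun y hy => interior_subset (hAU hy).1, fun y hy => ?_⟩
  by_contra hyr
  have hyV : (⟨y, hyr⟩ : ↥(range ι)ᶜ) ∈ V := by
    by_contra h
    exact (hAU hy.1).2 ⟨_, h, rfl⟩
  rw [hA.frontier_eq] at hy
  exact hy.2 (hVA ⟨_, hyV, rfl⟩)

/-- Right multiplication by a compact set moves points close to a boundary point little. -/
theorem eventually_rightExtension_mem (hX : IsSpeckerCompactification ι) {x : X}
    (hx : x ∉ range ι) {U : Set X} (hU : U ∈ 𝓝 x) {K : Set G} (hK : IsCompact K) :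
    ∀ᶠ y in 𝓝 x, ∀ k ∈ K, rightExtension ι (k, y) ∈ U := by
  refine hK.eventually_forall_of_forall_eventually fun k _ => ?_
  have h : ContinuousAt (fun z : X × G => rightExtension ι (z.2, z.1)) (x, k) :=
    (hX.continuous_rightExtension.comp continuous_swap).continuousAt
  refine h ?_
  simpa only [rightExtension_of_notMem_range hx] using hU

/-- A set whose frontier avoids the boundary has compact coboundary. -/
theorem exists_isCompact_forall_mem_iff_mul_mem (hX : IsSpeckerCompactification ι) {A : Set X}
    (hA : frontier A ⊆ range ι) {K : Set G} (hK : IsCompact K) :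
    ∃ C : Set G, IsCompact C ∧ ∀ h ∉ C, ∀ k ∈ K, (ι h ∈ A ↔ ι (h * k) ∈ A) := by
  have := hX.compactSpace
  let S : Set X := {y | ∀ k ∈ K, (y ∈ A ↔ rightExtension ι (k, y) ∈ A)}
  have hS : ∀ x ∉ range ι, x ∈ interior S := by
    intro x hx
    have hm := eventually_mem_iff_of_notMem_frontier fun h => hx (hA h)
    refine mem_interior_iff_mem_nhds.2 ?_
    filter_upwards [hm, hX.eventually_rightExtension_mem hx hm hK] with y hy hyK k hk
    exact hy.trans (hyK k hk).symm
  refine ⟨ι ⁻¹' (interior S)ᶜ, hX.isOpenEmbedding.isInducing.isCompact_preimage'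
    isOpen_interior.isClosed_compl.isCompact fun x hx => ?_, fun h hh k hk => ?_⟩
  · by_contra h
    exact hx (hS x h)
  · have := interior_subset (not_not.1 hh) k hk
    rwa [rightExtension_apply hX.isOpenEmbedding.injective] at this

theorem infinite (hX : IsSpeckerCompactification ι) : Infinite G := by
  have := hX.t2Space
  by_contra h
  have := not_infinite_iff_finite.1 h
  obtain ⟨x, hx⟩ := hX.boundary_nonempty
  exact hx (((finite_range ι).isClosed.closure_eq ▸ hX.denseRange x : x ∈ range ι))

/-! ### Continuity of the left action. -/

variable [IsTopologicalGroup G]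

/-- Left multiplication by elements close to `1` preserves membership in a set whose frontier
avoids the boundary, outside of a compact set. -/
theorem exists_isCompact_forall_mem_iff_smul_mem [LocallyCompactSpace G]
    (hX : IsSpeckerCompactification ι) (hG : IsCompactlyGeneratedGroup G) {A : Set X}
    (hA : frontier A ⊆ range ι) :
    ∃ N ∈ 𝓝 (1 : G), ∃ C : Set G, IsCompact C ∧ ∀ g ∈ N, ∀ h ∉ C, (ι h ∈ A ↔ ι (g * h) ∈ A) := by
  have := hX.compactSpace
  obtain ⟨K, hK, hKG⟩ := hG
  have hL : IsCompact (K ∪ K⁻¹) := hK.union hK.inv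
  have hLinv : ∀ k ∈ K ∪ K⁻¹, k⁻¹ ∈ K ∪ K⁻¹ := by
    rintro k (hk | hk)
    · exact Or.inr (by simpa using hk)
    · exact Or.inl hk
  obtain ⟨C₀, hC₀, hAC₀⟩ := hX.exists_isCompact_forall_mem_iff_mul_mem hA hL
  obtain ⟨N₀, hN₀, hN₀1⟩ := exists_compact_mem_nhds (1 : G)
  have hF : IsCompact (ι ⁻¹' frontier A) :=
    hX.isOpenEmbedding.isInducing.isCompact_preimage' isClosed_frontier.isCompact hA
  obtain ⟨C, hC, hsub⟩ := exists_compact_superset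
    (((isCompact_singleton (x := (1 : G))).union hC₀).union ((hN₀.inv.mul hC₀).union hF))
  -- A path by generators from outside `C` into `C` must leave from this compact shell. It avoids
  -- the frontier of `A`, so small `g` do not change membership there.
  have hQ : IsCompact ((C * (K ∪ K⁻¹)) \ interior C) := (hC.mul hL).diff isOpen_interior
  have hnear : ∀ᶠ g in 𝓝 (1 : G), ∀ p ∈ (C * (K ∪ K⁻¹)) \ interior C,
      (ι p ∈ A ↔ ι (g * p) ∈ A) := by
    refine hQ.eventually_forall_of_forall_eventually fun p hp => ?_
    have hpF : ι p ∉ frontier A := fun h => hp.2 (hsub (Or.inr (Or.inr h)))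
    have hm := eventually_mem_iff_of_notMem_frontier hpF
    have h₁ : Tendsto (fun z : G × G => ι z.2) (𝓝 (1, p)) (𝓝 (ι p)) :=
      (hX.isOpenEmbedding.continuous.comp continuous_snd).tendsto _
    have h₂ : Tendsto (fun z : G × G => ι (z.1 * z.2)) (𝓝 (1, p)) (𝓝 (ι p)) := by
      simpa [Function.comp_def] using
        (hX.isOpenEmbedding.continuous.comp continuous_mul).tendsto ((1 : G), p)
    filter_upwards [h₁.eventually hm, h₂.eventually hm] with z hz₁ hz₂
    exact hz₁.trans hz₂.symm
  have hC' : ∀ g ∈ N₀, ∀ h ∉ C, g * h ∉ C₀ := fun g hg h hh hgh =>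
    hh (interior_subset (hsub (Or.inr (Or.inl
      ⟨g⁻¹, by simpa using hg, g * h, hgh, by simp⟩))))
  refine ⟨_, inter_mem hN₀1 hnear, C, hC, fun g hg h hh => ?_⟩
  have hS := eq_empty_of_mul_mem_of_one_notMem (S := {p | p ∉ C ∧ ¬(ι p ∈ A ↔ ι (g * p) ∈ A)}) hKG
    (fun p hp k hk => ?_) fun h1 => h1.1 (interior_subset (hsub (Or.inl (Or.inl rfl))))
  · by_contra hne
    exact (hS ▸ (⟨hh, hne⟩ : h ∈ {p | p ∉ C ∧ ¬(ι p ∈ A ↔ ι (g * p) ∈ A)}) : h ∈ (∅ : Set G))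
  · refine ⟨fun hpk => hp.2 (hg.2 p ⟨⟨p * k, hpk, k⁻¹, hLinv k hk, by simp⟩,
      fun h => hp.1 (interior_subset h)⟩), ?_⟩
    -- Neither `p` nor `g * p` lies in `C₀`, so the discrepancy passes from `p` to `p * k`.
    rw [← hAC₀ p (fun h => hp.1 (interior_subset (hsub (Or.inl (Or.inr h))))) k hk,
      ← mul_assoc, ← hAC₀ _ (hC' g hg.1 p hp.1) k hk]
    exact hp.2

theorem continuousSMul_leftAction [LocallyCompactSpace G] (hX : IsSpeckerCompactification ι)
    (hG : IsCompactlyGeneratedGroup G) :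
    letI : MulAction G X := hX.leftAction
    ContinuousSMul G X := by
  let : MulAction G X := hX.leftAction
  have := hX.t2Space
  have smul_ι : ∀ g h : G, g • ι h = ι (g * h) := hX.leftExtension_apply
  have hcont : ∀ g : G, Continuous fun x : X => g • x := hX.continuous_leftExtension
  have hone : ∀ x : X, Tendsto (fun p : G × X => p.1 • p.2) (𝓝 (1, x)) (𝓝 x) := by
    intro x
    by_cases hx : x ∈ range ι
    · obtain ⟨h, rfl⟩ := hx
      rw [nhds_prod_eq, ← hX.isOpenEmbedding.map_nhds_eq, ← map_id (f := 𝓝 (1 : G)),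
        prod_map_map_eq, tendsto_map'_iff, ← nhds_prod_eq, hX.isOpenEmbedding.map_nhds_eq]
      have h₂ := (hX.isOpenEmbedding.continuous.comp continuous_mul).tendsto ((1 : G), h)
      simpa [Function.comp_def, smul_ι] using h₂
    · intro U hU
      obtain ⟨A, hA, hxA, hAU, hfr⟩ := hX.exists_isOpen_frontier_subset_range hx hU
      obtain ⟨N, hN, C, hC, hNC⟩ := hX.exists_isCompact_forall_mem_iff_smul_mem hG hfr
      have hO : IsOpen (A \ ι '' C) :=
        hA.sdiff (hC.image hX.isOpenEmbedding.continuous).isClosed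
      have hxO : x ∈ A \ ι '' C := ⟨hxA, fun h => hx (image_subset_range _ _ h)⟩
      rw [nhds_prod_eq]
      refine mem_map.2 (mem_of_superset (prod_mem_prod hN (hO.mem_nhds hxO)) ?_)
      rintro ⟨g, y⟩ ⟨hg, hy⟩
      refine hAU ?_
      have hy' : y ∈ closure ((A \ ι '' C) ∩ range ι) :=
        hX.denseRange.open_subset_closure_inter hO hy
      refine map_mem_closure (hcont g) hy' ?_
      rintro _ ⟨⟨hzA, hzC⟩, h, rfl⟩
      rw [smul_ι]
      exact (hNC g hg h fun hh => hzC ⟨h, hh, rfl⟩).1 hzA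
  refine ⟨continuous_iff_continuousAt.2 ?_⟩
  rintro ⟨g, x⟩
  -- Reduction to the identity: `p.1 • p.2 = g • ((g⁻¹ * p.1) • p.2)`.
  have h₁ : Tendsto (fun p : G × X => (g⁻¹ * p.1, p.2)) (𝓝 (g, x)) (𝓝 (1, x)) := by
    have : Continuous fun p : G × X => (g⁻¹ * p.1, p.2) := by fun_prop
    simpa using this.tendsto (g, x)
  have h₂ := ((hcont g).tendsto x).comp ((hone x).comp h₁)
  refine h₂.congr fun p => ?_
  simp [smul_smul]

/-! ### Convergence property and limit set. -/

/-- If `z` converges to `a` and its inverse converges to `b`, both in the boundary, then `z`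
collapses to `a` except at `b`. -/
theorem eventually_image_subset_of_tendsto (hX : IsSpeckerCompactification ι)
    (hG : IsCompactlyGeneratedGroup G) {D : Type w} {l : Filter D} {z : D → G} {a b : X}
    (ha : a ∉ range ι) (hb : b ∉ range ι) (hza : Tendsto (fun n => ι (z n)) l (𝓝 a))
    (hzb : Tendsto (fun n => ι (z n)⁻¹) l (𝓝 b)) {K : Set X} (hK : IsCompact K)
    (hbK : K ⊆ {b}ᶜ) {U : Set X} (hU : U ∈ 𝓝 a) :
    ∀ᶠ n in l, hX.leftExtension (z n) '' K ⊆ U := by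
  have := hX.t2Space
  have hinj := hX.isOpenEmbedding.injective
  obtain ⟨A, hA, haA, hAU, hAfr⟩ := hX.exists_isOpen_frontier_subset_range ha hU
  obtain ⟨B, hB, hbB, hBK, hBfr⟩ := hX.exists_isOpen_frontier_subset_range hb
    (hK.isClosed.isOpen_compl.mem_nhds fun h => hbK h rfl)
  obtain ⟨L, hL, hLG⟩ := hG
  have hL' : IsCompact (L ∪ L⁻¹) := hL.union hL.inv
  obtain ⟨C, hC, hAC⟩ := hX.exists_isCompact_forall_mem_iff_mul_mem hAfr hL'
  obtain ⟨C', hC', hBC'⟩ := hX.exists_isCompact_forall_mem_iff_mul_mem hBfr hL'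
  filter_upwards [hza.eventually (hA.mem_nhds haA),
    hza.eventually (hX.eventually_rightExtension_mem ha (hA.mem_nhds haA) hC'),
    hzb.eventually (hX.eventually_rightExtension_mem hb (hB.mem_nhds hbB) hC)] with n h1 h2 h3
  have hS := eq_empty_of_mul_mem_of_one_notMem (S := {p | ι p ∉ B ∧ ι (z n * p) ∉ A}) hLG
    (fun p hp k hk => ?_) fun h => h.2 (by rwa [mul_one])
  · rintro _ ⟨y, hy, rfl⟩
    refine hAU ?_
    have hyO : y ∈ (closure B)ᶜ := fun h => hBK h hy
    refine map_mem_closure (hX.continuous_leftExtension (z n))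
      (hX.denseRange.open_subset_closure_inter isClosed_closure.isOpen_compl hyO) ?_
    rintro _ ⟨hpB, p, rfl⟩
    rw [hX.leftExtension_apply]
    by_contra hpA
    have : p ∈ {p | ι p ∉ B ∧ ι (z n * p) ∉ A} := ⟨fun h => hpB (subset_closure h), hpA⟩
    simp [hS] at this
  -- If `p ∈ C'`, then `z n * p` is close to `z n`, hence in `A`; if `c = z n * p ∈ C`, then `p = (z
  -- n)⁻¹ * c` is close to `(z n)⁻¹`, hence in `B`.
  · have hpC' : p ∉ C' := fun h => hp.2 (by simpa [rightExtension_apply hinj] using h2 p h)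
    have hpC : z n * p ∉ C := fun h =>
      hp.1 (by simpa [rightExtension_apply hinj] using h3 _ h)
    refine ⟨fun h => hp.1 ((hBC' p hpC' k hk).2 h), fun h => hp.2 ((hAC _ hpC k hk).2 ?_)⟩
    rwa [mul_assoc]

/-- An ultrafilter on `G` that converges to a boundary point has inverse converging to a boundary
point. -/
theorem exists_tendsto_inv (hX : IsSpeckerCompactification ι) {D : Type w} (F : Ultrafilter D)
    {z : D → G} {a : X} (ha : a ∉ range ι) (hza : Tendsto (fun n => ι (z n)) F (𝓝 a)) :
    ∃ b ∉ range ι, Tendsto (fun n => ι (z n)⁻¹) F (𝓝 b) := by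
  have := hX.compactSpace
  have := hX.t2Space
  obtain ⟨b, -, hb⟩ := isCompact_univ.ultrafilter_le_nhds (F.map fun n => ι (z n)⁻¹) (by simp)
  refine ⟨b, ?_, hb⟩
  rintro ⟨h, rfl⟩
  have hz : Tendsto (fun n => (z n)⁻¹) F (𝓝 h) := hX.isOpenEmbedding.tendsto_nhds_iff.2 hb
  have hz' : Tendsto (fun n => ι (z n)) F (𝓝 (ι h⁻¹)) := by
    simpa [Function.comp_def] using (hX.isOpenEmbedding.continuous.tendsto _).comp hz.inv
  exact ha ⟨_, tendsto_nhds_unique hz' hza⟩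

theorem isConvergenceAction_leftAction (hX : IsSpeckerCompactification ι)
    (hG : IsCompactlyGeneratedGroup G) :
    letI : MulAction G X := hX.leftAction
    IsConvergenceAction.{u, v, w} G X := by
  let : MulAction G X := hX.leftAction
  intro D _ _ _ z hz
  have := hX.compactSpace
  -- Along an ultrafilter both `z` and its inverse converge in the compact space `X`.
  let F : Ultrafilter D := Ultrafilter.of atTop
  have hF : (F : Filter D) ≤ atTop := Ultrafilter.of_le atTop
  obtain ⟨a, -, ha⟩ := isCompact_univ.ultrafilter_le_nhds (F.map fun n => ι (z n)) (by simp)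
  have hza : Tendsto (fun n => ι (z n)) F (𝓝 a) := ha
  have har : a ∉ range ι := by
    rintro ⟨x, rfl⟩
    have hzx : Tendsto z F (𝓝 x) := hX.isOpenEmbedding.tendsto_nhds_iff.2 hza
    obtain ⟨E, i₁, i₂, i₃, N, hN⟩ := exists_net_tendsto.{w, u} (F : Filter D)
    exact hz ⟨x, E, i₁, i₂, i₃, N, fun d => (hN.mono_right hF).eventually_ge_atTop d,
      hzx.comp hN⟩
  obtain ⟨b, hb, hzb⟩ := hX.exists_tendsto_inv F har hza
  obtain ⟨E, i₁, i₂, i₃, N, hN⟩ := exists_net_tendsto.{w, max u v} (F : Filter D)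
  refine ⟨E, i₁, i₂, i₃, N, fun d => (hN.mono_right hF).eventually_ge_atTop d, b, a,
    fun K hK hbK U hU => ?_⟩
  exact hN.eventually (hX.eventually_image_subset_of_tendsto hG har hb hza hzb hK hbK hU)

theorem limitSet_leftAction [T2Space G] (hX : IsSpeckerCompactification ι)
    (hG : IsCompactlyGeneratedGroup G) :
    letI : MulAction G X := hX.leftAction
    limitSet.{u, v, w} G X = (range ι)ᶜ := by
  let : MulAction G X := hX.leftAction
  have hinj := hX.isOpenEmbedding.injective
  ext a
  constructor
  · rintro ⟨b, D, _, _, _, z, hz⟩ ⟨k, rfl⟩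
    -- An attractive point `ι k` would force `z` to converge to `k * h⁻¹` for all `h` but at most
    -- one, contradicting uniqueness of limits.
    have hlim : ∀ h, ι h ≠ b → Tendsto z atTop (𝓝 (k * h⁻¹)) := by
      intro h hb
      have hzh : Tendsto (fun n => ι (z n * h)) atTop (𝓝 (ι k)) := by
        intro U hU
        refine (hz {ι h} isCompact_singleton (by simpa using Ne.symm hb) U hU).mono fun n hn => ?_
        change ι (z n * h) ∈ U
        rw [← hX.leftExtension_apply]
        exact hn ⟨_, rfl, rfl⟩
      have hzh' : Tendsto (fun n => z n * h) atTop (𝓝 k) :=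
        hX.isOpenEmbedding.tendsto_nhds_iff.2 hzh
      simpa using hzh'.mul_const h⁻¹
    have := hX.infinite
    have hfin : (ι ⁻¹' {b}).Finite := (finite_singleton b).preimage hinj.injOn
    obtain ⟨h, hh, h', hh', hne⟩ := hfin.infinite_compl.nontrivial
    exact hne (by simpa using tendsto_nhds_unique (hlim h hh) (hlim h' hh'))
  · intro ha
    have : (comap ι (𝓝 a)).NeBot := comap_neBot_iff.2 fun U hU => (hX.denseRange.inter_nhds_nonempty hU).elim
      (by rintro _ ⟨⟨g, rfl⟩, hg⟩; exact ⟨g, hg⟩)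
    let F : Ultrafilter G := Ultrafilter.of (comap ι (𝓝 a))
    have hF : Tendsto (fun g => ι g) F (𝓝 a) := tendsto_comap.mono_left (Ultrafilter.of_le _)
    obtain ⟨b, hb, hFb⟩ := hX.exists_tendsto_inv F ha hF
    obtain ⟨E, i₁, i₂, i₃, N, hN⟩ := exists_net_tendsto.{u, max v w} (F : Filter G)
    refine ⟨b, E, i₁, i₂, i₃, N, fun K hK hbK U hU => ?_⟩
    exact hN.eventually (hX.eventually_image_subset_of_tendsto hG ha hb hF hFb hK hbK hU)

end IsSpeckerCompactification

theorem theoremD {G : Type u} [Group G] [TopologicalSpace G] [IsTopologicalGroup G]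
    [LocallyCompactSpace G] [T2Space G] (hG : IsCompactlyGeneratedGroup G)
    {X : Type v} [TopologicalSpace X] (ι : G → X) (hX : IsSpeckerCompactification ι) :
    letI : MulAction G X := hX.leftAction
    ContinuousSMul G X ∧ IsConvergenceAction.{u, v, w} G X ∧
      limitSet.{u, v, w} G X = (range ι)ᶜ :=
  ⟨hX.continuousSMul_leftAction hG, hX.isConvergenceAction_leftAction hG,
    hX.limitSet_leftAction hG⟩
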